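/- Let $(\mathcal M,g_{ab})$ be a four-dimensional Hausdorff smooth manifold with a smooth Lorentzian metric of signature $(-,+,+,+)$ and Levi-Civita connection $\nabla$. Let $m,n\in\mathbb N$ and $p\in\mathbb N^*$, and let $\gamma_1,\dots,\gamma_p$ be worldlines in $\mathcal M$: smooth injective timelike curves $I_{\mathrm i}\to\mathcal M$, parametrized by proper time $\tau_{\mathrm i}$ on a nonempty open interval $I_{\mathrm i}$, with unit tangent $u_{\mathrm i}^a$, which are proper (the set of $\tau_{\mathrm i}\in I_{\mathrm i}$ at which the curve lies in a given compact set is compact). Assume that no two of the worldlines have an arc in common: for $\mathrm i\neq \mathrm j$, the set of $\tau_{\mathrm i}\in I_{\mathrm i}$ with $\gamma_{\mathrm i}(\tau_{\mathrm i})\in\gamma_{\mathrm j}$ has empty interior (in particular the worldlines may be pairwise disjoint). For each $\mathrm i\in\{1,\dots,p\}$ and $k\in\{0,\dots,n\}$ let $\mathscr Y_{\mathrm i}^{MK}=\mathscr Y_{\mathrm i}^{a_1\cdots a_m c_1\cdots c_k}$ be a continuous contravariant tensor of rank $m+k$ along $\gamma_{\mathrm i}$ (here $M=a_1\cdots a_m$,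 $K=c_1\cdots c_k$), and consider the distributional multipolar expansions of order $n$ $$Y^M_{\mathrm i}(x)=\sum_{k=0}^n\nabla_{c_1}\cdots\nabla_{c_k}\int_{\gamma_{\mathrm i}}\mathscr Y_{\mathrm i}^{Mc_1\cdots c_k}(y_{\mathrm i})\,\delta_4(x,y_{\mathrm i})\,\mathrm d\tau_{\mathrm i},\qquad Y^M=\sum_{\mathrm i=1}^pY^M_{\mathrm i},$$ where $\delta_4$ is the invariant Dirac distribution; that is, $Y^M_{\mathrm i}$ is the distribution which sends a smooth compactly supported covariant tensor field $Z_M$ of rank $m$ to $$\sum_{k=0}^n(-1)^k\int_{I_{\mathrm i}}\mathscr Y_{\mathrm i}^{Mc_1\cdots c_k}\,\bigl(\nabla_{c_k}\cdots\nabla_{c_1}Z_M\bigr)\big|_{\gamma_{\mathrm i}(\tau_{\mathrm i})}\,\mathrm d\tau_{\mathrm i}.$$ Suppose that for all $\mathrm i\in\{1,\dots,p\}$ and $k\in\{0,\dots,n\}$ the multipole $\mathscr Y_{\mathrm i}^{MK}$ is symmetric with respect to any pair of indices of $K$ and orthogonal to $u_{\mathrm i}^a$ with respect to any index of $K$. Then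 $$Y^M=0\quad\Longleftrightarrow\quad \mathscr Y_{\mathrm i}^{MK}=0\ \text{ along }\gamma_{\mathrm i}\ \text{ for all }\mathrm i\in\{1,\dots,p\}\text{ and }k\in\{0,\dots,n\}.$$ -/

import Mathlib

open scoped Manifold ContDiff

noncomputable section

namespace Spacetime

/-- The coordinate space `ℝ⁴`. -/
abbrev E4 : Type := EuclideanSpace ℝ (Fin 4)

/-- The standard basis vector `∂_α` of the coordinate space. -/
def e (α : Fin 4) : E4 := EuclideanSpace.single α 1

section Tensors

variable {M : Type*} [TopologicalSpace M] [ChartedSpace E4 M]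

/-- Covariant tensors of rank `r` at `x`: multilinear forms on the tangent space. -/
abbrev CovTensor (r : ℕ) (x : M) : Type :=
  MultilinearMap ℝ (fun _ : Fin r => TangentSpace (𝓡 4) x) ℝ

/-- Contravariant tensors of rank `r` at `x`: multilinear forms on the cotangent space. -/
abbrev ContraTensor (r : ℕ) (x : M) : Type :=
  MultilinearMap ℝ (fun _ : Fin r => Module.Dual ℝ (TangentSpace (𝓡 4) x)) ℝ

/-- A basis of the tangent space at `x` (Mathlib's tangent spaces are copies of the model space). -/
def tangentBasis (x : M) : Module.Basis (Fin 4) ℝ (TangentSpace (𝓡 4) x) :=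
  (EuclideanSpace.basisFun (Fin 4) ℝ).toBasis

/-- The full contraction `Y^{a₁ ⋯ aᵣ} Z_{a₁ ⋯ aᵣ}` of a contravariant and a covariant tensor at the
same point, computed in a basis of the tangent space (the result does not depend on the basis). -/
def contract {r : ℕ} {x : M} (Y : ContraTensor r x) (Z : CovTensor r x) : ℝ :=
  ∑ A : Fin r → Fin 4,
    Y (fun j => (tangentBasis x).coord (A j)) * Z (fun j => tangentBasis x (A j))

/-- The coordinate vector field `∂_α` of the chart around `x₀`, at the point with coordinates `q`. -/
def coordVec (x₀ : M) (q : E4) (α : Fin 4) :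
    TangentSpace (𝓡 4) ((extChartAt (𝓡 4) x₀).symm q) :=
  mfderiv (𝓡 4) (𝓡 4) (extChartAt (𝓡 4) x₀).symm q (e α)

/-- The coordinate differential `dx^α` of the chart around `x₀`, at the point `y`. -/
def coordCovec (x₀ y : M) (α : Fin 4) : Module.Dual ℝ (TangentSpace (𝓡 4) y) :=
  (EuclideanSpace.proj α : E4 →L[ℝ] ℝ).toLinearMap ∘ₗ
    (mfderiv (𝓡 4) (𝓡 4) (extChartAt (𝓡 4) x₀) y).toLinearMap

/-- The components `Z_{α₁ ⋯ αᵣ}` of a covariant tensor field in the chart around `x₀`, as functions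
of the coordinates `q`. -/
def components {r : ℕ} (Z : ∀ x : M, CovTensor r x) (x₀ : M) :
    E4 → (Fin r → Fin 4) → ℝ :=
  fun q A => Z ((extChartAt (𝓡 4) x₀).symm q) (fun j => coordVec x₀ q (A j))

/-- The covariant tensor `∑ c_{α₁ ⋯ αᵣ} dx^{α₁} ⊗ ⋯ ⊗ dx^{αᵣ}` at `x`, in the chart around `x`. -/
def ofComponents {r : ℕ} (x : M) (c : (Fin r → Fin 4) → ℝ) : CovTensor r x :=
  ∑ A : Fin r → Fin 4,
    c A • (MultilinearMap.mkPiAlgebra ℝ (Fin r) ℝ).compLinearMap (fun j => coordCovec x x (A j))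

/-- Test tensors: smooth covariant tensor fields with compact support. -/
structure IsTestField {r : ℕ} (Z : ∀ x : M, CovTensor r x) : Prop where
  smooth : ∀ (x₀ : M) (A : Fin r → Fin 4),
    ContDiffOn ℝ ∞ (fun q => components Z x₀ q A) (extChartAt (𝓡 4) x₀).target
  compactSupport : IsCompact (closure {x : M | Z x ≠ 0})

end Tensors

/-- A smooth Lorentzian metric of signature `(-,+,+,+)`. -/
structure LorentzMetric (M : Type*) [TopologicalSpace M] [ChartedSpace E4 M] where
  /-- the value of the metric at a point, as a bilinear form -/
  val : ∀ x : M, TangentSpace (𝓡 4) x →ₗ[ℝ] TangentSpace (𝓡 4) x →ₗ[ℝ] ℝ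
  symm : ∀ (x : M) (v w : TangentSpace (𝓡 4) x), val x v w = val x w v
  signature : ∀ x : M, ∃ b : Module.Basis (Fin 4) ℝ (TangentSpace (𝓡 4) x),
    ∀ α β : Fin 4, val x (b α) (b β) = Matrix.diagonal ![(-1 : ℝ), 1, 1, 1] α β
  smooth : ∀ (x₀ : M) (α β : Fin 4),
    ContDiffOn ℝ ∞
      (fun q => val ((extChartAt (𝓡 4) x₀).symm q) (coordVec x₀ q α) (coordVec x₀ q β))
      (extChartAt (𝓡 4) x₀).target

section Coordinates

/-- The partial derivative `∂_α f` at `q`. -/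
def pderiv (α : Fin 4) (f : E4 → ℝ) (q : E4) : ℝ := fderiv ℝ f q (e α)

/-- The Christoffel symbol `Γ^σ_{αβ} = ½ g^{σδ} (∂_α g_{βδ} + ∂_β g_{αδ} - ∂_δ g_{αβ})` of the
metric with components `G`. -/
def christoffel (G : E4 → Matrix (Fin 4) (Fin 4) ℝ) (q : E4) (σ α β : Fin 4) : ℝ :=
  (1 / 2) * ∑ δ : Fin 4, (G q)⁻¹ σ δ *
    (pderiv α (fun q' => G q' β δ) q + pderiv β (fun q' => G q' α δ) q
      - pderiv δ (fun q' => G q' α β) q)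

/-- The Levi-Civita covariant derivative of a covariant tensor field in components; the derivative
index is the last one:
`(∇Z)_{α₁ ⋯ αᵣ γ} = ∂_γ Z_{α₁ ⋯ αᵣ} - ∑_j Γ^σ_{γ α_j} Z_{α₁ ⋯ σ ⋯ αᵣ}`. -/
def coordCovDeriv (G : E4 → Matrix (Fin 4) (Fin 4) ℝ) {r : ℕ}
    (z : E4 → (Fin r → Fin 4) → ℝ) : E4 → (Fin (r + 1) → Fin 4) → ℝ :=
  fun q A =>
    pderiv (A (Fin.last r)) (fun q' => z q' (fun j => A j.castSucc)) q
      - ∑ j : Fin r, ∑ σ : Fin 4, christoffel G q σ (A (Fin.last r)) (A j.castSucc) *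
          z q (Function.update (fun i : Fin r => A i.castSucc) j σ)

/-- The `k`-fold covariant derivative in components, with derivative indices `c₁, …, c_k` in the
last `k` slots: the component with indices `M c₁ ⋯ c_k` is `∇_{c_k} ⋯ ∇_{c₁} Z_M`. -/
def coordCovDerivIter (G : E4 → Matrix (Fin 4) (Fin 4) ℝ) {r : ℕ}
    (z : E4 → (Fin r → Fin 4) → ℝ) : (k : ℕ) → E4 → (Fin (r + k) → Fin 4) → ℝ
  | 0 => z
  | k + 1 => coordCovDeriv G (coordCovDerivIter G z k)

end Coordinates

section Multipoles

variable {M : Type*} [TopologicalSpace M] [ChartedSpace E4 M]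

/-- The components `g_{αβ}` of the metric in the chart around `x₀`. -/
def LorentzMetric.coord (g : LorentzMetric M) (x₀ : M) (q : E4) : Matrix (Fin 4) (Fin 4) ℝ :=
  Matrix.of fun α β =>
    g.val ((extChartAt (𝓡 4) x₀).symm q) (coordVec x₀ q α) (coordVec x₀ q β)

/-- The `k`-fold covariant derivative of a covariant tensor field, a covariant tensor field whose
last `k` slots are the derivative indices: `(M, c₁, …, c_k) ↦ ∇_{c_k} ⋯ ∇_{c₁} Z_M`. Its value at
`x` is computed in the chart around `x`. -/
def covDerivIter (g : LorentzMetric M) {r : ℕ} (Z : ∀ x : M, CovTensor r x) (k : ℕ) (x : M) :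
    CovTensor (r + k) x :=
  ofComponents x
    (coordCovDerivIter (g.coord x) (components Z x) k (extChartAt (𝓡 4) x x))

/-- A worldline: a smooth timelike curve without self-intersections, parametrized by proper time
`τ` on an open interval, which leaves every compact set at both ends. -/
structure Worldline (g : LorentzMetric M) where
  /-- the interval of proper time -/
  dom : Set ℝ
  /-- the parametrization (only its values on `dom` matter) -/
  pos : ℝ → M
  dom_open : IsOpen dom
  dom_interval : dom.OrdConnected
  dom_nonempty : dom.Nonempty
  smooth : ContMDiffOn 𝓘(ℝ, ℝ) (𝓡 4) ∞ pos dom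
  unit_timelike : ∀ τ ∈ dom,
    g.val (pos τ) (mfderiv 𝓘(ℝ, ℝ) (𝓡 4) pos τ (1 : ℝ)) (mfderiv 𝓘(ℝ, ℝ) (𝓡 4) pos τ (1 : ℝ)) = -1
  injective : Set.InjOn pos dom
  proper : ∀ K : Set M, IsCompact K → IsCompact (dom ∩ pos ⁻¹' K)

variable {g : LorentzMetric M}

/-- The set of points of a worldline. -/
def Worldline.image (γ : Worldline g) : Set M := γ.pos '' γ.dom

/-- The four-velocity `u^a`, the unit tangent of a worldline. -/
def Worldline.velocity (γ : Worldline g) (τ : ℝ) : TangentSpace (𝓡 4) (γ.pos τ) :=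
  mfderiv 𝓘(ℝ, ℝ) (𝓡 4) γ.pos τ (1 : ℝ)

/-- Contravariant tensors of rank `r` along a worldline. -/
abbrev TensorAlong (γ : Worldline g) (r : ℕ) : Type := ∀ τ : ℝ, ContraTensor r (γ.pos τ)

/-- Continuity of a contravariant tensor along a worldline: near each proper time `τ₀`, its
components in the chart around `γ(τ₀)` are continuous at `τ₀`. -/
def ContinuousAlong (γ : Worldline g) {r : ℕ} (Y : TensorAlong γ r) : Prop :=
  ∀ τ₀ ∈ γ.dom, ∀ A : Fin r → Fin 4,
    ContinuousAt (fun τ => Y τ (fun j => coordCovec (γ.pos τ₀) (γ.pos τ) (A j))) τ₀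

/-- `Y^{MK}`, with `M` of length `m` and `K` of length `k`, is symmetric in any pair of indices
of `K`. -/
def SymmetricInK (γ : Worldline g) {m k : ℕ} (Y : TensorAlong γ (m + k)) : Prop :=
  ∀ τ ∈ γ.dom, ∀ i j : Fin k,
    ∀ η : Fin (m + k) → Module.Dual ℝ (TangentSpace (𝓡 4) (γ.pos τ)),
      Y τ (fun l => η (Equiv.swap (Fin.natAdd m i) (Fin.natAdd m j) l)) = Y τ η

/-- `Y^{MK}`, with `M` of length `m` and `K` of length `k`, is orthogonal to the four-velocity in
every index of `K`: it vanishes when the covector `u_a = g_{ab} u^b` is inserted there. -/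
def OrthogonalInK (γ : Worldline g) {m k : ℕ} (Y : TensorAlong γ (m + k)) : Prop :=
  ∀ τ ∈ γ.dom, ∀ j : Fin k,
    ∀ η : Fin (m + k) → Module.Dual ℝ (TangentSpace (𝓡 4) (γ.pos τ)),
      η (Fin.natAdd m j) = g.val (γ.pos τ) (γ.velocity τ) → Y τ η = 0

/-- The distribution `∇_{c₁ ⋯ c_k} ∫_γ Y^{M c₁ ⋯ c_k}(y) δ₄(x, y) dτ`, as a functional of the test
tensor `Z_M`. Since `δ₄` is the invariant Dirac distribution and covariant derivatives of
distributions are defined by duality, it sends `Z_M` to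
`(-1)^k ∫_γ Y^{M c₁ ⋯ c_k} ∇_{c_k} ⋯ ∇_{c₁} Z_M dτ`. -/
def multipoleDistribution (γ : Worldline g) (m k : ℕ) (Y : TensorAlong γ (m + k)) :
    (∀ x : M, CovTensor m x) → ℝ :=
  fun Z => (-1) ^ k * ∫ τ in γ.dom, contract (Y τ) (covDerivIter g Z k (γ.pos τ))

/-- The distributional multipolar expansion
`∑_{k=0}^n ∇_K ∫_γ Y^{MK}(y) δ₄(x, y) dτ` of order `n`. -/
def multipolarExpansion (γ : Worldline g) (m n : ℕ)
    (Y : ∀ k : Fin (n + 1), TensorAlong γ (m + k)) : (∀ x : M, CovTensor m x) → ℝ :=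
  ∑ k : Fin (n + 1), multipoleDistribution γ m k (Y k)

/-- The functional `T` is zero as a distribution, that is, on all test tensors. -/
def IsZeroDistribution {m : ℕ} (T : (∀ x : M, CovTensor m x) → ℝ) : Prop :=
  ∀ Z : ∀ x : M, CovTensor m x, IsTestField Z → T Z = 0

end Multipoles

end Spacetime

end

/-!
The implication from right to left is immediate. For the converse the multipoles along a fixed
worldline `γ` are shown to vanish one order at a time, from the highest order down.

Suppose that all multipoles of order greater than `N` along `γ` vanish, while the one of order `N`
is nonzero at a point `γ(τ₀)` that lies on no other worldline. By symmetry, orthogonality and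
polarization (`exists_ne_zero_diagonal`) it is nonzero on some `η₁, …, η_m, ξ, …, ξ` with
`ξ(u) = 0`. There are smooth functions `H_j` with `dH_j = η_j` at `γ(τ₀)`, and a smooth `F` with
`dF = ξ` there that vanishes along `γ` near `γ(τ₀)`
(`Worldline.exists_contMDiff_vanishing`). The expansion is tested on
`Z = χ F ^ N dH₁ ⊗ ⋯ ⊗ dH_m`, with `χ ≥ 0` a bump function at `γ(τ₀)`. Properness makes the
worldlines closed and lets `γ` return to the support of `χ` only at proper times close to `τ₀`, so
only `γ` near `τ₀` contributes. There `F` vanishes, hence so do the derivatives of `Z` of order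
less than `N`, and the `N`-th one is `N! χ dH₁ ⊗ ⋯ ⊗ dH_m ⊗ dF ⊗ ⋯ ⊗ dF`
(`contract_covDerivIter_productTensor`). The expansion thus reduces to `± N!` times the integral of
`χ` times a continuous function that is nonzero at `τ₀`, which does not vanish if the support of `χ`
is small (`multipole_eq_zero_of_higher`).

Points on no other worldline are dense on `γ` (`exists_mem_forall_notMem_image`), and continuity of
the multipole extends its vanishing to all of `γ`.

`covDerivIter` is computed at each point in the chart around that point. The argument needs
no transformation law for Christoffel symbols: on the zero set of `F` the derivatives up to order
`N` only involve the differentials of the functions, in whichever chart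
(`coordCovDerivIter_pow_mul`).
-/

noncomputable section

namespace Spacetime

/-! ### Polarization of symmetric multilinear forms -/

section Polarization

theorem append_update_right {X : Type*} {m k : ℕ} (η : Fin m → X) (κ : Fin k → X) (i : Fin k)
    (a : X) :
    Fin.append η (Function.update κ i a)
      = Function.update (Fin.append η κ) (Fin.natAdd m i) a := by
  funext l
  refine Fin.addCases (fun j => ?_) (fun j => ?_) l
  · rw [Fin.append_left, Function.update_of_ne, Fin.append_left]
    simp only [ne_eq, Fin.ext_iff, Fin.val_castAdd, Fin.val_natAdd]
    omega
  · by_cases hj : j = i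
    · subst hj; simp
    · rw [Fin.append_right, Function.update_of_ne hj, Function.update_of_ne, Fin.append_right]
      exact fun h => hj (Fin.natAdd_injective k m h)

variable {V : Type*} [AddCommGroup V] [Module ℝ V] {ι : Type*} [Fintype ι]

/-- A function invariant under transposition of its arguments is invariant under permutations. -/
theorem comp_perm_eq_of_swap {β X : Type*} [DecidableEq ι] {φ : (ι → X) → β}
    (hφ : ∀ i j x, φ (x ∘ Equiv.swap i j) = φ x) (σ : Equiv.Perm ι) (x : ι → X) :
    φ (x ∘ σ) = φ x := by
  induction σ using Equiv.Perm.swap_induction_on generalizing x with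
  | one => rfl
  | swap_mul σ i j _ ih =>
    rw [Equiv.Perm.coe_mul, ← Function.comp_assoc, ih, hφ]

/-- Inclusion-exclusion: the alternating sum over the sets `s ⊇ range r` detects whether `r` is
surjective. -/
theorem sum_alternating_of_range_subset [DecidableEq ι] (r : ι → ι) :
    ∑ s : Finset ι, (-1 : ℝ) ^ (sᶜ.card) * (if ∀ j, r j ∈ s then 1 else 0)
      = if Function.Surjective r then 1 else 0 := by
  have h := Finset.prod_add (fun _ : ι => (1 : ℝ)) (fun i => if i ∈ Set.range r then 0 else -1)
    Finset.univ
  have hl : ∏ i : ι, ((1 : ℝ) + (if i ∈ Set.range r then 0 else -1))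
      = if Function.Surjective r then 1 else 0 := by
    split_ifs with hr
    · exact Finset.prod_eq_one fun i _ => by simp [hr.range_eq]
    · obtain ⟨i, hi⟩ := not_forall.1 hr
      exact Finset.prod_eq_zero (Finset.mem_univ i) (by simp [hi])
  rw [← hl, h, Finset.powerset_univ]
  refine Finset.sum_congr rfl fun s _ => ?_
  rw [Finset.prod_const_one, one_mul, ← Finset.compl_eq_univ_sdiff]
  split_ifs with hs
  · rw [mul_one, ← Finset.prod_const]
    refine Finset.prod_congr rfl fun i hi => ?_
    rw [if_neg]
    rintro ⟨j, rfl⟩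
    exact Finset.mem_compl.1 hi (hs j)
  · obtain ⟨j, hj⟩ := not_forall.1 hs
    rw [mul_zero]
    exact (Finset.prod_eq_zero (Finset.mem_compl.2 hj) (by simp)).symm

/-- The polarization identity for symmetric multilinear forms of any degree. -/
theorem sum_alternating_diagonal [DecidableEq ι] (φ : MultilinearMap ℝ (fun _ : ι => V) ℝ)
    (hφ : ∀ i j x, φ (x ∘ Equiv.swap i j) = φ x) (x : ι → V) :
    ∑ s : Finset ι, (-1 : ℝ) ^ (sᶜ.card) * φ (fun _ => ∑ i ∈ s, x i)
      = (Fintype.card ι).factorial * φ x := by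
  have h1 (s : Finset ι) : φ (fun _ => ∑ i ∈ s, x i)
      = ∑ r : ι → ι, (if ∀ j, r j ∈ s then 1 else 0) * φ (x ∘ r) := by
    rw [φ.map_sum_finset (fun _ => x) (fun _ => s)]
    rw [← Finset.sum_filter_add_sum_filter_not Finset.univ (fun r : ι → ι => ∀ j, r j ∈ s)]
    rw [Finset.sum_eq_zero (s := Finset.univ.filter fun r : ι → ι => ¬ ∀ j, r j ∈ s), add_zero]
    · refine Finset.sum_congr (by ext; simp) fun r hr => ?_
      rw [if_pos (by simpa using hr), one_mul]; rfl
    · intro r hr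
      rw [if_neg (by simpa using hr), zero_mul]
  simp_rw [h1, Finset.mul_sum]
  rw [Finset.sum_comm]
  have h2 (r : ι → ι) : ∑ s : Finset ι,
      (-1 : ℝ) ^ (sᶜ.card) * ((if ∀ j, r j ∈ s then 1 else 0) * φ (x ∘ r))
      = (if Function.Bijective r then φ x else 0) := by
    simp_rw [← mul_assoc]
    rw [← Finset.sum_mul, sum_alternating_of_range_subset]
    by_cases hr : Function.Surjective r
    · have hb : Function.Bijective r := ⟨Finite.injective_iff_surjective.2 hr, hr⟩
      rw [if_pos hr, if_pos hb, one_mul]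
      exact comp_perm_eq_of_swap (φ := φ) hφ (Equiv.ofBijective r hb) x
    · rw [if_neg hr, if_neg fun hb => hr hb.2, zero_mul]
  simp_rw [h2]
  rw [← Finset.sum_filter, Finset.sum_const, nsmul_eq_mul]
  congr 2
  rw [← Fintype.card_perm, ← Fintype.card_subtype]
  exact (Fintype.card_congr (Equiv.ofBijective
    (fun σ : Equiv.Perm ι => (⟨σ, σ.bijective⟩ : {r : ι → ι // Function.Bijective r}))
    ⟨fun a b h => by simpa using congrArg Subtype.val h,
      fun r => ⟨Equiv.ofBijective r.1 r.2, by ext; rfl⟩⟩)).symm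

/-- A symmetric multilinear form is determined by its diagonal. -/
theorem eq_zero_of_diagonal_eq_zero [DecidableEq ι] (φ : MultilinearMap ℝ (fun _ : ι => V) ℝ)
    (hφ : ∀ i j x, φ (x ∘ Equiv.swap i j) = φ x) (h0 : ∀ v, φ (fun _ => v) = 0) (x : ι → V) :
    φ x = 0 := by
  have h := sum_alternating_diagonal φ hφ x
  simp only [h0, mul_zero, Finset.sum_const_zero] at h
  exact (mul_eq_zero.1 h.symm).resolve_left (by positivity)

/-- If a multilinear form vanishes whenever one argument equals `w`, multiples of `w` may be
subtracted from the arguments. -/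
theorem map_sub_smul_eq [DecidableEq ι] (φ : MultilinearMap ℝ (fun _ : ι => V) ℝ) {w : V}
    (hw : ∀ (x : ι → V) (j : ι), x j = w → φ x = 0) (x : ι → V) (c : ι → ℝ) :
    φ (fun j => x j - c j • w) = φ x := by
  have h : ∀ s : Finset ι, φ (fun j => if j ∈ s then x j - c j • w else x j) = φ x := by
    intro s
    induction s using Finset.induction_on with
    | empty => simp
    | insert a s ha ih =>
      rw [← ih]
      have e1 : (fun j => if j ∈ insert a s then x j - c j • w else x j)
          = Function.update (fun j => if j ∈ s then x j - c j • w else x j) a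
            (x a - c a • w) := by
        funext j
        by_cases hj : j = a
        · subst hj; simp
        · simp [hj]
      rw [e1, φ.map_update_sub, φ.map_update_smul,
        hw (Function.update _ a w) a (by simp), smul_zero, sub_zero]
      congr 1
      funext j
      by_cases hj : j = a
      · subst hj; simp [ha]
      · simp [hj]
  simpa using h Finset.univ

/-- A nonzero tensor that is symmetric in its last `k` slots and vanishes when `w` is inserted there
is nonzero on a tuple whose last `k` entries coincide and lie in the kernel of a functional `L`
with `L w ≠ 0`. -/
theorem exists_ne_zero_diagonal {m k : ℕ} (Y : MultilinearMap ℝ (fun _ : Fin (m + k) => V) ℝ)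
    (hsymm : ∀ (i j : Fin k) (η : Fin (m + k) → V),
      Y (fun l => η (Equiv.swap (Fin.natAdd m i) (Fin.natAdd m j) l)) = Y η)
    {w : V} (horth : ∀ (j : Fin k) (η : Fin (m + k) → V), η (Fin.natAdd m j) = w → Y η = 0)
    (L : V →ₗ[ℝ] ℝ) (hL : L w ≠ 0) (hY : Y ≠ 0) :
    ∃ (η : Fin m → V) (ξ : V), L ξ = 0 ∧ Y (Fin.append η (fun _ => ξ)) ≠ 0 := by
  by_contra! hcon
  refine hY (MultilinearMap.ext fun x => ?_)
  let η : Fin m → V := fun i => x (Fin.castAdd k i)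
  let φ : MultilinearMap ℝ (fun _ : Fin k => V) ℝ :=
    { toFun := fun κ => Y (Fin.append η κ)
      map_update_add' := by
        intro inst κ i a b
        rw [Subsingleton.elim inst (instDecidableEqFin k)]
        simp only [append_update_right, Y.map_update_add]
      map_update_smul' := by
        intro inst κ i a b
        rw [Subsingleton.elim inst (instDecidableEqFin k)]
        simp only [append_update_right, Y.map_update_smul] }
  have hφ (κ : Fin k → V) : φ κ = Y (Fin.append η κ) := rfl
  have hx : Fin.append η (fun j => x (Fin.natAdd m j)) = x := by
    funext l
    refine Fin.addCases (fun i => ?_) (fun i => ?_) l <;> simp [η]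
  have hmain := eq_zero_of_diagonal_eq_zero φ ?_ ?_ (fun j => x (Fin.natAdd m j))
  · rw [hφ, hx] at hmain
    rw [hmain]; rfl
  · intro i j κ
    rw [hφ, hφ, ← hsymm i j]
    congr 1
    funext l
    refine Fin.addCases (fun a => ?_) (fun a => ?_) l
    · rw [Equiv.swap_apply_of_ne_of_ne] <;> simp [Fin.ext_iff] <;> omega
    · rw [Fin.append_right, (Fin.natAdd_injective k m).swap_apply, Fin.append_right]
      simp
  · intro v
    -- Project `v` along `w` to the kernel of `L`.
    have hs := map_sub_smul_eq φ (w := w)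
      (fun κ j hj => horth j _ (by rw [Fin.append_right, hj])) (fun _ => v)
      (fun _ => L v / L w)
    rw [← hs]
    exact hcon η _ (by simp [hL])

end Polarization

/-! ### Covariant derivatives of powers, in components -/

section Coordinates

variable {Ω : Set E4} {G : E4 → Matrix (Fin 4) (Fin 4) ℝ}

theorem contDiffOn_pderiv (hΩ : IsOpen Ω) {f : E4 → ℝ} (hf : ContDiffOn ℝ ∞ f Ω) (α : Fin 4) :
    ContDiffOn ℝ ∞ (pderiv α f) Ω :=
  (hf.fderiv_of_isOpen hΩ (by simp)).clm_apply contDiffOn_const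

theorem contDiffOn_det {A : E4 → Matrix (Fin 4) (Fin 4) ℝ}
    (hA : ∀ α β, ContDiffOn ℝ ∞ (fun q => A q α β) Ω) :
    ContDiffOn ℝ ∞ (fun q => (A q).det) Ω := by
  simp only [Matrix.det_apply']
  exact ContDiffOn.sum fun σ _ => contDiffOn_const.mul (contDiffOn_prod fun i _ => hA _ _)

theorem contDiffOn_inv_apply (hG : ∀ α β, ContDiffOn ℝ ∞ (fun q => G q α β) Ω)
    (hdet : ∀ q ∈ Ω, (G q).det ≠ 0) (α β : Fin 4) :
    ContDiffOn ℝ ∞ (fun q => (G q)⁻¹ α β) Ω := by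
  simp only [Matrix.inv_def, Ring.inverse_eq_inv', Matrix.smul_apply, smul_eq_mul,
    Matrix.adjugate_apply]
  refine ((contDiffOn_det hG).inv hdet).mul (contDiffOn_det fun i j => ?_)
  by_cases hi : i = β
  · subst hi
    simpa only [Matrix.updateRow_self] using contDiffOn_const
  · simpa only [Matrix.updateRow_ne hi] using hG i j

theorem contDiffOn_christoffel (hΩ : IsOpen Ω) (hG : ∀ α β, ContDiffOn ℝ ∞ (fun q => G q α β) Ω)
    (hdet : ∀ q ∈ Ω, (G q).det ≠ 0) (σ α β : Fin 4) :
    ContDiffOn ℝ ∞ (fun q => christoffel G q σ α β) Ω :=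
  contDiffOn_const.mul (ContDiffOn.sum fun δ _ => (contDiffOn_inv_apply hG hdet σ δ).mul
    (((contDiffOn_pderiv hΩ (hG β δ) α).add (contDiffOn_pderiv hΩ (hG α δ) β)).sub
      (contDiffOn_pderiv hΩ (hG α β) δ)))

theorem contDiffOn_coordCovDeriv (hΩ : IsOpen Ω)
    (hG : ∀ α β, ContDiffOn ℝ ∞ (fun q => G q α β) Ω) (hdet : ∀ q ∈ Ω, (G q).det ≠ 0)
    {r : ℕ} {z : E4 → (Fin r → Fin 4) → ℝ} (hz : ∀ A, ContDiffOn ℝ ∞ (fun q => z q A) Ω)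
    (A : Fin (r + 1) → Fin 4) :
    ContDiffOn ℝ ∞ (fun q => coordCovDeriv G z q A) Ω :=
  (contDiffOn_pderiv hΩ (hz _) _).sub (ContDiffOn.sum fun _ _ => ContDiffOn.sum fun _ _ =>
    (contDiffOn_christoffel hΩ hG hdet _ _ _).mul (hz _))

/-- The covariant derivative is local. -/
theorem coordCovDeriv_congr (hΩ : IsOpen Ω) {r : ℕ} {z z' : E4 → (Fin r → Fin 4) → ℝ}
    (h : ∀ q ∈ Ω, z q = z' q) {q : E4} (hq : q ∈ Ω) :
    coordCovDeriv G z q = coordCovDeriv G z' q := by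
  funext A
  have hev : (fun q' => z q' (fun j => A j.castSucc))
      =ᶠ[nhds q] (fun q' => z' q' (fun j => A j.castSucc)) :=
    Filter.eventuallyEq_of_mem (hΩ.mem_nhds hq) fun q' hq' => by
      rw [h q' hq']
  simp only [coordCovDeriv, pderiv, h q hq, hev.fderiv_eq]

theorem coordCovDerivIter_congr (hΩ : IsOpen Ω) {r : ℕ} {z z' : E4 → (Fin r → Fin 4) → ℝ}
    (h : ∀ q ∈ Ω, z q = z' q) (k : ℕ) :
    ∀ q ∈ Ω, coordCovDerivIter G z k q = coordCovDerivIter G z' k q := by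
  induction k with
  | zero => exact h
  | succ k ih => exact fun q hq => coordCovDeriv_congr hΩ ih hq

theorem coordCovDerivIter_zero {r : ℕ} (k : ℕ) :
    coordCovDerivIter G (fun _ => (0 : (Fin r → Fin 4) → ℝ)) k = fun _ => 0 := by
  induction k with
  | zero => rfl
  | succ k ih =>
    rw [coordCovDerivIter, ih]
    funext q A
    simp [coordCovDeriv, pderiv]

/-- The Leibniz rule for the product of a function and a tensor field. -/
theorem coordCovDeriv_mul {r : ℕ} {f : E4 → ℝ} {z : E4 → (Fin r → Fin 4) → ℝ} {q : E4}
    (hf : DifferentiableAt ℝ f q) (hz : ∀ A, DifferentiableAt ℝ (fun q' => z q' A) q)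
    (A : Fin (r + 1) → Fin 4) :
    coordCovDeriv G (fun q' B => f q' * z q' B) q A
      = pderiv (A (Fin.last r)) f q * z q (fun j => A j.castSucc)
        + f q * coordCovDeriv G z q A := by
  have h : pderiv (A (Fin.last r)) (fun q' => f q' * z q' (fun j => A j.castSucc)) q
      = pderiv (A (Fin.last r)) f q * z q (fun j => A j.castSucc)
        + f q * pderiv (A (Fin.last r)) (fun q' => z q' (fun j => A j.castSucc)) q := by
    simp only [pderiv]
    rw [fderiv_fun_mul hf (hz _)]
    simp only [add_apply, smul_apply, smul_eq_mul]
    ring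
  simp only [coordCovDeriv]
  rw [h, mul_sub, Finset.mul_sum]
  simp only [Finset.mul_sum]
  rw [add_sub_assoc]
  congr 2
  exact Finset.sum_congr rfl fun j _ => Finset.sum_congr rfl fun σ _ => by ring

/-- The `k`-fold covariant derivative of `f ^ N w` is `f ^ (N - k)` times a smooth tensor field
whose value on the zero set of `f` is `N! / (N - k)!` times `w ⊗ df ⊗ ⋯ ⊗ df`: the Christoffel
symbols only enter through terms with a further factor `f`. -/
theorem coordCovDerivIter_pow_mul (hΩ : IsOpen Ω)
    (hG : ∀ α β, ContDiffOn ℝ ∞ (fun q => G q α β) Ω) (hdet : ∀ q ∈ Ω, (G q).det ≠ 0)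
    {r : ℕ} {w : E4 → (Fin r → Fin 4) → ℝ} (hw : ∀ A, ContDiffOn ℝ ∞ (fun q => w q A) Ω)
    {f : E4 → ℝ} (hf : ContDiffOn ℝ ∞ f Ω) (N k : ℕ) (hk : k ≤ N) :
    ∃ T : E4 → (Fin (r + k) → Fin 4) → ℝ,
      (∀ A, ContDiffOn ℝ ∞ (fun q => T q A) Ω) ∧
      (∀ q ∈ Ω, coordCovDerivIter G (fun q' A => f q' ^ N * w q' A) k q
        = fun A => f q ^ (N - k) * T q A) ∧
      (∀ q ∈ Ω, f q = 0 → ∀ A, T q A = N.descFactorial k * (w q (fun j => A (Fin.castAdd k j))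
        * ∏ j : Fin k, pderiv (A (Fin.natAdd r j)) f q)) := by
  induction k with
  | zero => exact ⟨w, hw, fun q _ => rfl, fun q _ _ A => by simp⟩
  | succ k ih =>
    obtain ⟨T, hT, hiter, hval⟩ := ih (by omega)
    refine ⟨fun q A => ((N - k : ℕ) : ℝ) * (pderiv (A (Fin.last (r + k))) f q
      * T q (fun j => A j.castSucc)) + f q * coordCovDeriv G T q A, fun A => ?_, fun q hq => ?_,
      fun q hq h0 A => ?_⟩
    · exact (contDiffOn_const.mul ((contDiffOn_pderiv hΩ hf _).mul (hT _))).add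
        (hf.mul (contDiffOn_coordCovDeriv hΩ hG hdet hT A))
    · have hdf : DifferentiableAt ℝ f q :=
        (hf.contDiffAt (hΩ.mem_nhds hq)).differentiableAt (by simp)
      have hdT (A) : DifferentiableAt ℝ (fun q' => T q' A) q :=
        ((hT A).contDiffAt (hΩ.mem_nhds hq)).differentiableAt (by simp)
      refine (coordCovDeriv_congr hΩ hiter hq).trans ?_
      funext A
      rw [coordCovDeriv_mul (hdf.fun_pow _) hdT]
      obtain ⟨d, hd⟩ : ∃ d, N - k = d + 1 := ⟨N - k - 1, by omega⟩
      have hd' : N - (k + 1) = d := by omega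
      have hp : pderiv (A (Fin.last (r + k))) (fun q' => f q' ^ (N - k)) q
          = ((N - k : ℕ) : ℝ) * f q ^ d * pderiv (A (Fin.last (r + k))) f q := by
        simp only [pderiv]
        rw [fderiv_fun_pow _ hdf, hd]
        simp [mul_assoc]
      rw [hp, hd', hd]
      push_cast
      ring
    · simp only [h0, zero_mul, add_zero]
      rw [hval q hq h0, Nat.descFactorial_succ, Fin.prod_univ_castSucc]
      push_cast
      have e1 : (Fin.natAdd r (Fin.last k) : Fin (r + (k + 1))) = Fin.last (r + k) := rfl
      have e2 : (fun j : Fin r => A (Fin.castAdd k j).castSucc)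
          = (fun j : Fin r => A (Fin.castAdd (k + 1) j)) := rfl
      have e3 (j : Fin k) : A (Fin.natAdd r j).castSucc = A (Fin.natAdd r j.castSucc) := rfl
      simp only [e1, e2, e3]
      ring

end Coordinates

/-! ### Differentials of functions and coordinate frames -/

section Charts

variable {M : Type*} [TopologicalSpace M] [ChartedSpace E4 M]

/-- The differential `dF` of a function at `x`, as a covector. -/
def differential (F : M → ℝ) (x : M) : Module.Dual ℝ (TangentSpace (𝓡 4) x) :=
  (mfderiv (𝓡 4) 𝓘(ℝ, ℝ) F x).toLinearMap

/-- The tensor field `χ dF₁ ⊗ ⋯ ⊗ dF_m`. -/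
def productTensor {m : ℕ} (χ : M → ℝ) (F : Fin m → M → ℝ) (x : M) : CovTensor m x :=
  χ x • (MultilinearMap.mkPiAlgebra ℝ (Fin m) ℝ).compLinearMap (fun j => differential (F j) x)

theorem productTensor_apply {m : ℕ} (χ : M → ℝ) (F : Fin m → M → ℝ) (x : M)
    (v : Fin m → TangentSpace (𝓡 4) x) :
    productTensor χ F x v = χ x * ∏ j, differential (F j) x (v j) := rfl

/-- A linear map on the coordinate space is determined by its values on the basis vectors. -/
theorem map_eq_sum_coord (L : E4 →L[ℝ] ℝ) (v : E4) : L v = ∑ β : Fin 4, L (e β) * v β := by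
  conv_lhs => rw [← (EuclideanSpace.basisFun (Fin 4) ℝ).sum_repr v]
  simp only [map_sum, map_smul, smul_eq_mul, EuclideanSpace.basisFun_repr,
    EuclideanSpace.basisFun_apply, e]
  exact Finset.sum_congr rfl fun _ _ => mul_comm _ _

/-- The full contraction with a tensor given by its components. -/
theorem contract_ofComponents {r : ℕ} {x : M} (Y : ContraTensor r x)
    (c : (Fin r → Fin 4) → ℝ) :
    contract Y (ofComponents x c) = ∑ B, c B * Y (fun j => coordCovec x x (B j)) := by
  have hY (B : Fin r → Fin 4) : Y (fun j => coordCovec x x (B j))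
      = ∑ A : Fin r → Fin 4, (∏ j, coordCovec x x (B j) (tangentBasis x (A j)))
          * Y (fun j => (tangentBasis x).coord (A j)) := by
    have h (j : Fin r) : coordCovec x x (B j)
        = ∑ α : Fin 4, coordCovec x x (B j) (tangentBasis x α) • (tangentBasis x).coord α :=
      ((tangentBasis x).sum_dual_apply_smul_coord _).symm
    calc Y (fun j => coordCovec x x (B j))
        = Y (fun j => ∑ α : Fin 4,
            coordCovec x x (B j) (tangentBasis x α) • (tangentBasis x).coord α) :=
          congrArg Y (funext h)
      _ = _ := by
          rw [Y.map_sum]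
          exact Finset.sum_congr rfl fun A _ => by rw [Y.map_smul_univ, smul_eq_mul]
  have hZ (A : Fin r → Fin 4) : ofComponents x c (fun j => tangentBasis x (A j))
      = ∑ B, c B * ∏ j, coordCovec x x (B j) (tangentBasis x (A j)) := by
    rw [ofComponents, sum_apply]
    rfl
  simp only [contract, hZ, hY, Finset.mul_sum]
  rw [Finset.sum_comm]
  exact Finset.sum_congr rfl fun B _ => Finset.sum_congr rfl fun A _ => by ring

section Smooth

variable [IsManifold (𝓡 4) ∞ M]

theorem contDiffOn_comp_symm {F : M → ℝ} (hF : ContMDiff (𝓡 4) 𝓘(ℝ, ℝ) ∞ F) (x₀ : M) :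
    ContDiffOn ℝ ∞ (fun q => F ((extChartAt (𝓡 4) x₀).symm q)) (extChartAt (𝓡 4) x₀).target :=
  (hF.comp_contMDiffOn (contMDiffOn_extChartAt_symm x₀)).contDiffOn

theorem mdifferentiableAt_extChartAt_symm {x₀ : M} {q : E4}
    (hq : q ∈ (extChartAt (𝓡 4) x₀).target) :
    MDifferentiableAt (𝓡 4) (𝓡 4) (extChartAt (𝓡 4) x₀).symm q :=
  ((contMDiffOn_extChartAt_symm (n := ∞) x₀).contMDiffAt
    ((isOpen_extChartAt_target x₀).mem_nhds hq)).mdifferentiableAt (by simp)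

theorem differential_coordVec {F : M → ℝ} (hF : ContMDiff (𝓡 4) 𝓘(ℝ, ℝ) ∞ F) {x₀ : M} {q : E4}
    (hq : q ∈ (extChartAt (𝓡 4) x₀).target) (β : Fin 4) :
    differential F ((extChartAt (𝓡 4) x₀).symm q) (coordVec x₀ q β)
      = pderiv β (fun q' => F ((extChartAt (𝓡 4) x₀).symm q')) q := by
  have h := mfderiv_comp q ((hF.mdifferentiable (by simp)) ((extChartAt (𝓡 4) x₀).symm q))
    (mdifferentiableAt_extChartAt_symm hq)
  rw [pderiv, ← mfderiv_eq_fderiv]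
  exact (congrArg (fun L => L (e β)) h).symm

/-- The expansion `dF = ∂_β F dx^β`. -/
theorem differential_eq_sum {F : M → ℝ} (hF : ContMDiff (𝓡 4) 𝓘(ℝ, ℝ) ∞ F) {x₀ y : M}
    (hy : y ∈ (extChartAt (𝓡 4) x₀).source) :
    differential F y = ∑ β : Fin 4,
      pderiv β (fun q' => F ((extChartAt (𝓡 4) x₀).symm q')) (extChartAt (𝓡 4) x₀ y)
        • coordCovec x₀ y β := by
  set φ := extChartAt (𝓡 4) x₀
  have hev : F =ᶠ[nhds y] (fun q' => F (φ.symm q')) ∘ φ := by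
    filter_upwards [extChartAt_source_mem_nhds' hy] with z hz
    exact (congrArg F (φ.left_inv hz)).symm
  have hd : MDifferentiableAt 𝓘(ℝ, E4) 𝓘(ℝ, ℝ) (fun q' => F (φ.symm q')) (φ y) :=
    (((contDiffOn_comp_symm hF x₀).contDiffAt
      ((isOpen_extChartAt_target x₀).mem_nhds (φ.map_source hy))).differentiableAt
        (by simp)).mdifferentiableAt
  have h := mfderiv_comp y hd (mdifferentiableAt_extChartAt (I := 𝓡 4) (x := x₀) (y := y)
    (by rwa [← extChartAt_source (𝓡 4)]))
  rw [mfderiv_eq_fderiv] at h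
  ext v
  have h2 : differential F y v
      = fderiv ℝ (fun q' => F (φ.symm q')) (φ y) (mfderiv (𝓡 4) (𝓡 4) φ y v) := by
    rw [differential, hev.mfderiv_eq]
    exact congrArg (fun L => L v) h
  refine h2.trans ((map_eq_sum_coord _ _).trans ?_)
  rw [LinearMap.sum_apply]
  rfl

theorem isInvertible_mfderiv_extChartAt_symm {x₀ : M} {q : E4}
    (hq : q ∈ (extChartAt (𝓡 4) x₀).target) :
    (mfderiv (𝓡 4) (𝓡 4) (extChartAt (𝓡 4) x₀).symm q).IsInvertible := by
  have : IsManifold (𝓡 4) 1 M := IsManifold.of_le (n := ∞) (by simp)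
  have h := isInvertible_mfderivWithin_extChartAt_symm (I := 𝓡 4) (x := x₀) hq
  simpa using h

/-- Every covector is the pullback of a linear form on the coordinate space. -/
theorem exists_linear_of_covector (x₀ : M) (ξ : Module.Dual ℝ (TangentSpace (𝓡 4) x₀)) :
    ∃ ℓ : E4 →L[ℝ] ℝ,
      ∀ v, ℓ (mfderiv (𝓡 4) (𝓡 4) (extChartAt (𝓡 4) x₀) x₀ v) = ξ v := by
  have : IsManifold (𝓡 4) 1 M := IsManifold.of_le (n := ∞) (by simp)
  obtain ⟨E, hE⟩ := isInvertible_mfderiv_extChartAt (I := 𝓡 4) (mem_extChartAt_source x₀)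
  let E' : TangentSpace (𝓡 4) x₀ ≃ₗ[ℝ] E4 := E.toLinearEquiv
  refine ⟨LinearMap.toContinuousLinearMap (ξ ∘ₗ E'.symm.toLinearMap), fun v => ?_⟩
  rw [← hE]
  exact congrArg ξ (E'.symm_apply_apply v)

end Smooth

end Charts

/-! ### The leading order of covariant derivatives -/

section LeadingOrder

variable {M : Type*} [TopologicalSpace M] [ChartedSpace E4 M]

/-- A Lorentzian metric is nondegenerate. -/
theorem LorentzMetric.nondegenerate (g : LorentzMetric M) (x : M) {v : TangentSpace (𝓡 4) x}
    (hv : ∀ w, g.val x w v = 0) : v = 0 := by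
  obtain ⟨b, hb⟩ := g.signature x
  have h (α : Fin 4) : b.repr v α = 0 := by
    have h1 := hv (b α)
    rw [← b.sum_repr v] at h1
    simp only [map_sum, map_smul, hb, smul_eq_mul, Matrix.diagonal_apply] at h1
    fin_cases α <;> simpa [Fin.sum_univ_four] using h1
  rw [← b.sum_repr v]
  simp [h]

theorem ofComponents_zero {r : ℕ} (x : M) : ofComponents (r := r) x 0 = 0 := by
  simp [ofComponents]

/-- The covariant derivatives of a field vanish outside its support. -/
theorem covDerivIter_eq_zero_of_eventuallyEq (g : LorentzMetric M) {r : ℕ}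
    {Z : ∀ x : M, CovTensor r x} {x : M} (hZ : ∀ᶠ y in nhds x, Z y = 0) (k : ℕ) :
    covDerivIter g Z k x = 0 := by
  have hmem : (extChartAt (𝓡 4) x).target ∩ (extChartAt (𝓡 4) x).symm ⁻¹' {y | Z y = 0}
      ∈ nhds (extChartAt (𝓡 4) x x) := by
    refine Filter.inter_mem (extChartAt_target_mem_nhds x) ?_
    refine (continuousAt_extChartAt_symm x).preimage_mem_nhds ?_
    rwa [extChartAt_to_inv]
  obtain ⟨Ω, hΩsub, hΩ, hx⟩ := mem_nhds_iff.1 hmem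
  rw [covDerivIter, coordCovDerivIter_congr (z' := fun _ => 0) hΩ _ k _ hx, coordCovDerivIter_zero,
    ofComponents_zero]
  intro q hq
  funext A
  have h0 : Z ((extChartAt (𝓡 4) x).symm q) = 0 := (hΩsub hq).2
  exact congrArg (fun T => T (fun j => coordVec x q (A j))) h0

variable [IsManifold (𝓡 4) ∞ M]

/-- The coordinate vector fields form a basis of the tangent space. -/
theorem exists_basis_coordVec (x₀ : M) {q : E4} (hq : q ∈ (extChartAt (𝓡 4) x₀).target) :
    ∃ b : Module.Basis (Fin 4) ℝ (TangentSpace (𝓡 4) ((extChartAt (𝓡 4) x₀).symm q)),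
      ∀ α, b α = coordVec x₀ q α := by
  obtain ⟨E, hE⟩ := isInvertible_mfderiv_extChartAt_symm hq
  let E' : E4 ≃ₗ[ℝ] TangentSpace (𝓡 4) ((extChartAt (𝓡 4) x₀).symm q) := E.toLinearEquiv
  refine ⟨(EuclideanSpace.basisFun (Fin 4) ℝ).toBasis.map E', fun α => ?_⟩
  rw [Module.Basis.map_apply, OrthonormalBasis.coe_toBasis, EuclideanSpace.basisFun_apply, coordVec,
    ← hE]
  rfl

/-- The components of the metric in a chart form an invertible matrix. -/
theorem LorentzMetric.det_coord_ne_zero (g : LorentzMetric M) (x₀ : M) {q : E4}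
    (hq : q ∈ (extChartAt (𝓡 4) x₀).target) : (g.coord x₀ q).det ≠ 0 := by
  intro hdet
  obtain ⟨v, hv, hGv⟩ := Matrix.exists_mulVec_eq_zero_iff.2 hdet
  obtain ⟨b, hb⟩ := exists_basis_coordVec x₀ hq
  have hX0 : ∑ β, v β • b β = 0 := by
    refine g.nondegenerate _ fun w => ?_
    have hα (α : Fin 4) : g.val _ (b α) (∑ β, v β • b β) = 0 := by
      have := congrFun hGv α
      simp only [Matrix.mulVec, dotProduct, LorentzMetric.coord, Matrix.of_apply,
        Pi.zero_apply] at this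
      rw [← this, map_sum]
      exact Finset.sum_congr rfl fun β _ => by rw [map_smul, smul_eq_mul, mul_comm, hb, hb]
    generalize (∑ β, v β • b β) = X at hα ⊢
    rw [← b.sum_repr w, map_sum, LinearMap.sum_apply]
    exact Finset.sum_eq_zero fun α _ => by
      rw [map_smul, LinearMap.smul_apply, hα, smul_zero]
  exact hv (funext (Fintype.linearIndependent_iff.1 b.linearIndependent v hX0))

theorem components_productTensor {m : ℕ} {χ : M → ℝ} {F : Fin m → M → ℝ}
    (hF : ∀ j, ContMDiff (𝓡 4) 𝓘(ℝ, ℝ) ∞ (F j)) {x₀ : M} {q : E4}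
    (hq : q ∈ (extChartAt (𝓡 4) x₀).target) (A : Fin m → Fin 4) :
    components (productTensor χ F) x₀ q A = χ ((extChartAt (𝓡 4) x₀).symm q)
      * ∏ j, pderiv (A j) (fun q' => F j ((extChartAt (𝓡 4) x₀).symm q')) q := by
  rw [components, productTensor_apply]
  congr 1
  exact Finset.prod_congr rfl fun j _ => differential_coordVec (hF j) hq (A j)

theorem contDiffOn_components_productTensor {m : ℕ} {χ : M → ℝ} {F : Fin m → M → ℝ}
    (hχ : ContMDiff (𝓡 4) 𝓘(ℝ, ℝ) ∞ χ) (hF : ∀ j, ContMDiff (𝓡 4) 𝓘(ℝ, ℝ) ∞ (F j)) (x₀ : M)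
    (A : Fin m → Fin 4) :
    ContDiffOn ℝ ∞ (fun q => components (productTensor χ F) x₀ q A)
      (extChartAt (𝓡 4) x₀).target := by
  refine ContDiffOn.congr ?_ fun q hq => components_productTensor hF hq A
  exact (contDiffOn_comp_symm hχ x₀).mul (contDiffOn_prod fun j _ =>
    contDiffOn_pderiv (isOpen_extChartAt_target x₀) (contDiffOn_comp_symm (hF j) x₀) _)

theorem isTestField_productTensor {m : ℕ} {χ : M → ℝ} {F : Fin m → M → ℝ}
    (hχ : ContMDiff (𝓡 4) 𝓘(ℝ, ℝ) ∞ χ) (hF : ∀ j, ContMDiff (𝓡 4) 𝓘(ℝ, ℝ) ∞ (F j))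
    (hsupp : HasCompactSupport χ) : IsTestField (productTensor χ F) where
  smooth := contDiffOn_components_productTensor hχ hF
  compactSupport := by
    refine IsCompact.of_isClosed_subset hsupp isClosed_closure (closure_mono fun x hx h0 => hx ?_)
    ext v
    rw [productTensor_apply, h0, zero_mul, zero_apply]

variable {m : ℕ} {χ F : M → ℝ} {H : Fin m → M → ℝ}

/-- The components of the `k`-fold covariant derivative of `χ F ^ N dH₁ ⊗ ⋯ ⊗ dH_m` on the zero set
of `F`, for `k ≤ N`. -/
theorem coordCovDerivIter_components (g : LorentzMetric M)
    (hχ : ContMDiff (𝓡 4) 𝓘(ℝ, ℝ) ∞ χ) (hF : ContMDiff (𝓡 4) 𝓘(ℝ, ℝ) ∞ F)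
    (hH : ∀ j, ContMDiff (𝓡 4) 𝓘(ℝ, ℝ) ∞ (H j)) {N k : ℕ} (hk : k ≤ N) {x : M} (hx : F x = 0)
    (A : Fin (m + k) → Fin 4) :
    coordCovDerivIter (g.coord x) (components (productTensor (fun y => χ y * F y ^ N) H) x) k
        (extChartAt (𝓡 4) x x) A
      = 0 ^ (N - k) * (N.descFactorial k * (χ x
        * ∏ l : Fin (m + k), pderiv (A l) (fun q =>
            (Fin.append H (fun _ => F) : Fin (m + k) → M → ℝ) l ((extChartAt (𝓡 4) x).symm q))
          (extChartAt (𝓡 4) x x))) := by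
  set φ := extChartAt (𝓡 4) x
  have hxT : φ x ∈ φ.target := φ.map_source (mem_extChartAt_source x)
  have hφx : φ.symm (φ x) = x := extChartAt_to_inv x
  obtain ⟨T, -, hiter, hval⟩ := coordCovDerivIter_pow_mul (G := g.coord x)
    (isOpen_extChartAt_target x) (g.smooth x) (fun q hq => g.det_coord_ne_zero x hq)
    (contDiffOn_components_productTensor hχ hH x) (contDiffOn_comp_symm hF x) N k hk
  have h1 : ∀ q ∈ φ.target, components (productTensor (fun y => χ y * F y ^ N) H) x q
      = fun A => F (φ.symm q) ^ N * components (productTensor χ H) x q A := by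
    intro q hq
    funext A
    rw [components_productTensor hH hq, components_productTensor hH hq]
    ring
  have hFx : F (φ.symm (φ x)) = 0 := by rw [hφx, hx]
  rw [coordCovDerivIter_congr (isOpen_extChartAt_target x) h1 k _ hxT, hiter _ hxT]
  simp only
  rw [hval _ hxT hFx, hFx, components_productTensor hH hxT, Fin.prod_univ_add, hφx]
  simp only [Fin.append_left, Fin.append_right, mul_assoc]
  rfl

theorem covDerivIter_productTensor_eq_zero (g : LorentzMetric M)
    (hχ : ContMDiff (𝓡 4) 𝓘(ℝ, ℝ) ∞ χ) (hF : ContMDiff (𝓡 4) 𝓘(ℝ, ℝ) ∞ F)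
    (hH : ∀ j, ContMDiff (𝓡 4) 𝓘(ℝ, ℝ) ∞ (H j)) {N k : ℕ} (hk : k < N) {x : M} (hx : F x = 0) :
    covDerivIter g (productTensor (fun y => χ y * F y ^ N) H) k x = 0 := by
  rw [covDerivIter, ← ofComponents_zero]
  congr 1
  funext A
  rw [coordCovDerivIter_components g hχ hF hH hk.le hx, zero_pow (by omega), zero_mul,
    Pi.zero_apply]

/-- On the zero set of `F`, the `N`-fold covariant derivative of `χ F ^ N dH₁ ⊗ ⋯ ⊗ dH_m` is
`N! χ dH₁ ⊗ ⋯ ⊗ dH_m ⊗ dF ⊗ ⋯ ⊗ dF`. -/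
theorem contract_covDerivIter_productTensor (g : LorentzMetric M)
    (hχ : ContMDiff (𝓡 4) 𝓘(ℝ, ℝ) ∞ χ) (hF : ContMDiff (𝓡 4) 𝓘(ℝ, ℝ) ∞ F)
    (hH : ∀ j, ContMDiff (𝓡 4) 𝓘(ℝ, ℝ) ∞ (H j)) {N : ℕ} {x : M} (hx : F x = 0)
    (Y : ContraTensor (m + N) x) :
    contract Y (covDerivIter g (productTensor (fun y => χ y * F y ^ N) H) N x)
      = N.factorial * (χ x * Y (fun l =>
        differential ((Fin.append H (fun _ => F) : Fin (m + N) → M → ℝ) l) x)) := by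
  have hsmooth (l : Fin (m + N)) :
      ContMDiff (𝓡 4) 𝓘(ℝ, ℝ) ∞ ((Fin.append H (fun _ => F) : Fin (m + N) → M → ℝ) l) := by
    refine Fin.addCases (fun j => ?_) (fun j => ?_) l
    · rw [Fin.append_left]; exact hH j
    · rw [Fin.append_right]; exact hF
  have hY := congrArg Y (funext fun l =>
    differential_eq_sum (hsmooth l) (mem_extChartAt_source (I := 𝓡 4) x))
  rw [Y.map_sum] at hY
  rw [covDerivIter, contract_ofComponents, hY]
  simp only [Finset.mul_sum]
  refine Finset.sum_congr rfl fun A _ => ?_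
  rw [coordCovDerivIter_components g hχ hF hH le_rfl hx, Y.map_smul_univ, smul_eq_mul,
    Nat.sub_self, pow_zero, Nat.descFactorial_self]
  ring

end LeadingOrder

/-! ### Topology of worldlines and continuity along them -/

section Worldlines

variable {M : Type*} [TopologicalSpace M] [ChartedSpace E4 M] {g : LorentzMetric M}

theorem Worldline.continuousOn (γ : Worldline g) : ContinuousOn γ.pos γ.dom :=
  γ.smooth.continuousOn

theorem Worldline.continuousAt (γ : Worldline g) {τ : ℝ} (hτ : τ ∈ γ.dom) :
    ContinuousAt γ.pos τ :=
  γ.continuousOn.continuousAt (γ.dom_open.mem_nhds hτ)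

theorem Worldline.velocity_ne_zero (γ : Worldline g) {τ : ℝ} (hτ : τ ∈ γ.dom) :
    γ.velocity τ ≠ 0 := by
  intro h
  have h1 : g.val (γ.pos τ) (γ.velocity τ) (γ.velocity τ) = -1 := γ.unit_timelike τ hτ
  rw [h, map_zero] at h1
  norm_num at h1

/-- A proper worldline returns to a small neighborhood of `γ(τ₀)` only at proper times close
to `τ₀`. -/
theorem Worldline.exists_nhds_preimage_subset [T2Space M] (γ : Worldline g) {S : Set ℝ}
    {x₀ : M} (hS : IsOpen S) (h : ∀ τ ∈ γ.dom, γ.pos τ = x₀ → τ ∈ S) :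
    ∃ U ∈ nhds x₀, ∀ τ ∈ γ.dom, γ.pos τ ∈ U → τ ∈ S := by
  have : LocallyCompactSpace M := ChartedSpace.locallyCompactSpace E4 M
  obtain ⟨K, hK, hx₀⟩ := exists_compact_mem_nhds x₀
  have hC : IsCompact ((γ.dom ∩ γ.pos ⁻¹' K) \ S) := (γ.proper K hK).diff hS
  have hcl : IsClosed (γ.pos '' ((γ.dom ∩ γ.pos ⁻¹' K) \ S)) :=
    (hC.image_of_continuousOn (γ.continuousOn.mono fun τ hτ => hτ.1.1)).isClosed
  refine ⟨K ∩ (γ.pos '' ((γ.dom ∩ γ.pos ⁻¹' K) \ S))ᶜ,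
    Filter.inter_mem hx₀ (hcl.isOpen_compl.mem_nhds ?_), fun τ hτ hU => ?_⟩
  · rintro ⟨τ, hτ, hx⟩
    exact hτ.2 (h τ hτ.1.1 hx)
  · by_contra hτS
    exact hU.2 ⟨τ, ⟨⟨hτ, hU.1⟩, hτS⟩, rfl⟩

theorem Worldline.isClosed_image [T2Space M] (γ : Worldline g) : IsClosed γ.image := by
  rw [← isOpen_compl_iff, isOpen_iff_mem_nhds]
  intro x hx
  obtain ⟨U, hU, h⟩ := γ.exists_nhds_preimage_subset (x₀ := x) (S := ∅) isOpen_empty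
    fun τ hτ hτx => hx ⟨τ, hτ, hτx⟩
  filter_upwards [hU] with y hy
  rintro ⟨τ, hτ, rfl⟩
  exact h τ hτ hy

/-- Finitely many worldlines without common arcs: on every open set of proper times of the `i`-th
worldline there are points that lie on none of the others. -/
theorem exists_mem_forall_notMem_image [T2Space M] {p : ℕ} (γ : Fin p → Worldline g)
    (hγ : ∀ i j : Fin p, i ≠ j →
      interior {τ : ℝ | τ ∈ (γ i).dom ∧ (γ i).pos τ ∈ (γ j).image} = ∅)
    (i : Fin p) {V : Set ℝ} (hV : IsOpen V) (hVdom : V ⊆ (γ i).dom) (hne : V.Nonempty) :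
    ∃ τ ∈ V, ∀ j, j ≠ i → (γ i).pos τ ∉ (γ j).image := by
  have key : ∀ s : Finset (Fin p), i ∉ s → ∃ W : Set ℝ, IsOpen W ∧ W.Nonempty ∧ W ⊆ V ∧
      ∀ τ ∈ W, ∀ j ∈ s, (γ i).pos τ ∉ (γ j).image := by
    intro s
    induction s using Finset.induction_on with
    | empty => exact fun _ => ⟨V, hV, hne, subset_rfl, by simp⟩
    | insert j s hj ih =>
      intro hi
      simp only [Finset.mem_insert, not_or] at hi
      obtain ⟨W, hW, hWne, hWV, hWs⟩ := ih hi.2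
      refine ⟨W ∩ (γ i).pos ⁻¹' (γ j).imageᶜ, ?_, ?_, Set.inter_subset_left.trans hWV, ?_⟩
      · exact ((γ i).continuousOn.mono (hWV.trans hVdom)).isOpen_inter_preimage hW
          (γ j).isClosed_image.isOpen_compl
      · by_contra hemp
        have hsub : W ⊆ interior {τ : ℝ | τ ∈ (γ i).dom ∧ (γ i).pos τ ∈ (γ j).image} := by
          refine interior_maximal (fun τ hτ => ⟨hVdom (hWV hτ), ?_⟩) hW
          by_contra hτj
          exact hemp ⟨τ, hτ, hτj⟩
        rw [hγ i j hi.1] at hsub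
        exact hWne.not_subset_empty hsub
      · intro τ hτ l hl
        rcases Finset.mem_insert.1 hl with rfl | hl
        · exact hτ.2
        · exact hWs τ hτ.1 l hl
  obtain ⟨W, -, ⟨τ, hτ⟩, hWV, h⟩ := key (Finset.univ.erase i) (by simp)
  exact ⟨τ, hWV hτ, fun j hj => h τ hτ j (by simp [hj])⟩

variable [IsManifold (𝓡 4) ∞ M]

/-- The coordinate differentials of the chart around `x` span the cotangent space at `x`, so a
tensor is determined by its components. -/
theorem eq_zero_of_coordCovec (x : M) {r : ℕ} (Y : ContraTensor r x)
    (h : ∀ A : Fin r → Fin 4, Y (fun j => coordCovec x x (A j)) = 0) : Y = 0 := by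
  have : IsManifold (𝓡 4) 1 M := IsManifold.of_le (n := ∞) (by simp)
  obtain ⟨E, hE⟩ := isInvertible_mfderiv_extChartAt (I := 𝓡 4) (mem_extChartAt_source x)
  let E' : TangentSpace (𝓡 4) x ≃ₗ[ℝ] E4 := E.toLinearEquiv
  have hE' (v) : E' v = mfderiv (𝓡 4) (𝓡 4) (extChartAt (𝓡 4) x) x v := by rw [← hE]; rfl
  have hexp (η : Module.Dual ℝ (TangentSpace (𝓡 4) x)) :
      η = ∑ α, η (E'.symm (e α)) • coordCovec x x α := by
    ext v
    have h1 := map_eq_sum_coord (LinearMap.toContinuousLinearMap (η ∘ₗ E'.symm.toLinearMap)) (E' v)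
    have h2 : η (E'.symm (E' v)) = ∑ α, η (E'.symm (e α)) * E' v α := h1
    rw [E'.symm_apply_apply, hE'] at h2
    rw [h2, LinearMap.sum_apply]
    rfl
  ext η
  rw [zero_apply, show η = fun l => ∑ α, η l (E'.symm (e α)) • coordCovec x x α from
    funext fun l => hexp (η l), Y.map_sum]
  exact Finset.sum_eq_zero fun A _ => by rw [Y.map_smul_univ, h, smul_zero]

/-- The contraction of a continuous tensor along a worldline with differentials of smooth functions
is continuous. -/
theorem ContinuousAlong.continuousAt_differential {γ : Worldline g} {r : ℕ} {Y : TensorAlong γ r}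
    (hY : ContinuousAlong γ Y) {F : Fin r → M → ℝ}
    (hF : ∀ l, ContMDiff (𝓡 4) 𝓘(ℝ, ℝ) ∞ (F l)) {τ₁ : ℝ} (hτ₁ : τ₁ ∈ γ.dom) :
    ContinuousAt (fun τ => Y τ (fun l => differential (F l) (γ.pos τ))) τ₁ := by
  set x₁ := γ.pos τ₁ with hx₁
  set φ := extChartAt (𝓡 4) x₁ with hφ
  have hev : (fun τ => Y τ (fun l => differential (F l) (γ.pos τ))) =ᶠ[nhds τ₁]
      fun τ => ∑ A : Fin r → Fin 4,
        (∏ l, pderiv (A l) (fun q => F l (φ.symm q)) (φ (γ.pos τ)))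
          * Y τ (fun l => coordCovec x₁ (γ.pos τ) (A l)) := by
    filter_upwards [(γ.continuousAt hτ₁).preimage_mem_nhds
      (extChartAt_source_mem_nhds (I := 𝓡 4) x₁)] with τ hτ
    rw [show (fun l => differential (F l) (γ.pos τ)) = fun l => ∑ β : Fin 4,
      pderiv β (fun q' => F l (φ.symm q')) (φ (γ.pos τ)) • coordCovec x₁ (γ.pos τ) β from
        funext fun l => differential_eq_sum (hF l) hτ, (Y τ).map_sum]
    exact Finset.sum_congr rfl fun A _ => by rw [(Y τ).map_smul_univ, smul_eq_mul]
  refine ContinuousAt.congr_of_eventuallyEq ?_ hev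
  refine tendsto_finsetSum _ fun A _ => Filter.Tendsto.mul (tendsto_finsetProd _ fun l _ => ?_)
    (hY τ₁ hτ₁ A)
  have hpd : ContinuousAt (pderiv (A l) (fun q => F l (φ.symm q))) (φ x₁) :=
    (contDiffOn_pderiv (isOpen_extChartAt_target x₁) (contDiffOn_comp_symm (hF l) x₁)
      (A l)).continuousOn.continuousAt (extChartAt_target_mem_nhds x₁)
  exact hpd.comp_of_eq ((continuousAt_extChartAt x₁).comp (γ.continuousAt hτ₁)) rfl

/-- A continuous tensor along a worldline that vanishes on a dense set of proper times vanishes. -/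
theorem ContinuousAlong.eq_zero_of_dense {γ : Worldline g} {r : ℕ} {Y : TensorAlong γ r}
    (hY : ContinuousAlong γ Y) {P : ℝ → Prop}
    (hP : ∀ V : Set ℝ, IsOpen V → V ⊆ γ.dom → V.Nonempty → ∃ τ ∈ V, P τ)
    (h0 : ∀ τ ∈ γ.dom, P τ → Y τ = 0) {τ : ℝ} (hτ : τ ∈ γ.dom) : Y τ = 0 := by
  refine eq_zero_of_coordCovec _ _ fun A => ?_
  by_contra hne
  have hev := (hY τ hτ A).eventually_ne hne
  obtain ⟨V, hVsub, hV, hτV⟩ := mem_nhds_iff.1 (Filter.inter_mem hev (γ.dom_open.mem_nhds hτ))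
  obtain ⟨σ, hσ, hPσ⟩ := hP V hV (fun x hx => (hVsub hx).2) ⟨τ, hτV⟩
  refine (hVsub hσ).1 ?_
  rw [h0 σ (hVsub hσ).2 hPσ, zero_apply]

end Worldlines

/-! ### Functions with prescribed differential vanishing along a worldline -/

section Construction

/-- If `a' ≠ 0` and `b' = 0` at `t₀`, then near `t₀` the function `b` factors through `a` by a
smooth function with vanishing derivative at `a t₀`. -/
theorem exists_factor_of_deriv_ne_zero {J : Set ℝ} (hJ : IsOpen J) {a b : ℝ → ℝ}
    (ha : ContDiffOn ℝ ∞ a J) (hb : ContDiffOn ℝ ∞ b J) {t₀ : ℝ} (ht₀ : t₀ ∈ J)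
    (ha' : deriv a t₀ ≠ 0) (hb' : deriv b t₀ = 0) :
    ∃ (k : ℝ → ℝ) (V : Set ℝ), IsOpen V ∧ a t₀ ∈ V ∧ ContDiffOn ℝ ∞ k V ∧
      HasDerivAt k 0 (a t₀) ∧ ∀ᶠ t in nhds t₀, k (a t) = b t := by
  have hat {t : ℝ} (ht : t ∈ J) : ContDiffAt ℝ ∞ a t := ha.contDiffAt (hJ.mem_nhds ht)
  have hda {t : ℝ} (ht : t ∈ J) : HasDerivAt a (deriv a t) t :=
    ((hat ht).differentiableAt (by simp)).hasDerivAt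
  set R := (hat ht₀).toOpenPartialHomeomorph a ((hda ht₀).hasFDerivAt_equiv ha') (by simp) with hR
  have hRa : (R : ℝ → ℝ) = a := rfl
  have hmem : t₀ ∈ R.source :=
    (hat ht₀).mem_toOpenPartialHomeomorph_source ((hda ht₀).hasFDerivAt_equiv ha') (by simp)
  have hS : IsOpen {t | t ∈ J ∧ deriv a t ≠ 0} :=
    (ha.continuousOn_deriv_of_isOpen hJ (by simp)).isOpen_inter_preimage hJ isOpen_ne
  have hinv : R.symm (a t₀) = t₀ := R.left_inv hmem
  have hsymm {y : ℝ} (hy : y ∈ R.target) (hyS : R.symm y ∈ {t | t ∈ J ∧ deriv a t ≠ 0}) :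
      ContDiffAt ℝ ∞ R.symm y :=
    R.contDiffAt_symm_deriv hyS.2 hy (hda hyS.1) (hat hyS.1)
  have htgt : a t₀ ∈ R.target := R.map_source hmem
  refine ⟨b ∘ R.symm, R.target ∩ R.symm ⁻¹' {t | t ∈ J ∧ deriv a t ≠ 0},
    R.isOpen_inter_preimage_symm hS, ⟨htgt, ?_⟩, fun y hy => ?_, ?_, ?_⟩
  · simpa only [Set.mem_preimage, hinv] using ⟨ht₀, ha'⟩
  · exact ((hb.contDiffAt (hJ.mem_nhds hy.2.1)).comp y (hsymm hy.1 hy.2)).contDiffWithinAt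
  · have h1 : HasDerivAt R.symm (deriv R.symm (a t₀)) (a t₀) :=
      ((hsymm htgt (by simpa only [hinv] using ⟨ht₀, ha'⟩)).differentiableAt (by simp)).hasDerivAt
    have h2 : HasDerivAt b 0 (R.symm (a t₀)) := by
      rw [hinv, ← hb']
      exact ((hb.contDiffAt (hJ.mem_nhds ht₀)).differentiableAt (by simp)).hasDerivAt
    simpa using h2.comp (a t₀) h1
  · filter_upwards [R.open_source.mem_nhds hmem] with t ht
    exact congrArg b (R.left_inv ht)

variable {M : Type*} [TopologicalSpace M] [T2Space M] [ChartedSpace E4 M] [IsManifold (𝓡 4) ∞ M]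

/-- Smooth bump functions at `x₀` with arbitrarily small support. -/
theorem exists_contMDiff_bump {x₀ : M} {U : Set M} (hU : U ∈ nhds x₀) :
    ∃ χ : M → ℝ, ContMDiff (𝓡 4) 𝓘(ℝ, ℝ) ∞ χ ∧ HasCompactSupport χ ∧ tsupport χ ⊆ U ∧
      (∀ᶠ x in nhds x₀, χ x = 1) ∧ ∀ x, 0 ≤ χ x := by
  obtain ⟨f, -, hf⟩ := (SmoothBumpFunction.nhds_basis_tsupport (I := 𝓡 4) x₀).mem_iff.1 hU
  exact ⟨f, f.contMDiff, f.hasCompactSupport, hf, f.eventuallyEq_one, fun _ => f.nonneg⟩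

/-- A smooth function of the coordinates, defined near the coordinates of `x₀`, agrees near `x₀`
with a smooth function on the manifold. -/
theorem exists_contMDiff_extension (x₀ : M) {Ω : Set E4} (hΩ : IsOpen Ω)
    (hx₀ : extChartAt (𝓡 4) x₀ x₀ ∈ Ω) {f : E4 → ℝ} (hf : ContDiffOn ℝ ∞ f Ω) :
    ∃ F : M → ℝ, ContMDiff (𝓡 4) 𝓘(ℝ, ℝ) ∞ F ∧
      (∀ᶠ x in nhds x₀, F x = f (extChartAt (𝓡 4) x₀ x)) ∧
      ∀ v, differential F x₀ v
        = fderiv ℝ f (extChartAt (𝓡 4) x₀ x₀) (mfderiv (𝓡 4) (𝓡 4) (extChartAt (𝓡 4) x₀) x₀ v) := by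
  set φ := extChartAt (𝓡 4) x₀ with hφ
  have hW : IsOpen (φ.source ∩ φ ⁻¹' Ω) :=
    (continuousOn_extChartAt x₀).isOpen_inter_preimage (isOpen_extChartAt_source x₀) hΩ
  obtain ⟨χ, hχ, -, hsub, hone, -⟩ := exists_contMDiff_bump (x₀ := x₀)
    (hW.mem_nhds ⟨mem_extChartAt_source x₀, hx₀⟩)
  have hloc : ∀ x ∈ φ.source ∩ φ ⁻¹' Ω, ContMDiffAt (𝓡 4) 𝓘(ℝ, ℝ) ∞ (f ∘ φ) x := by
    intro x hx
    have h1 : ContMDiffAt (𝓡 4) 𝓘(ℝ, E4) ∞ φ x :=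
      contMDiffAt_extChartAt' (by rw [← extChartAt_source (𝓡 4)]; exact hx.1)
    exact (hf.contDiffAt (hΩ.mem_nhds hx.2)).contMDiffAt.comp x h1
  have hev : ∀ᶠ x in nhds x₀, χ x * f (φ x) = f (φ x) := by
    filter_upwards [hone] with x hx
    rw [hx, one_mul]
  refine ⟨fun x => χ x * f (φ x), contMDiff_of_tsupport fun x hx => ?_, hev, fun v => ?_⟩
  · exact (hχ x).mul (hloc x (hsub (tsupport_mul_subset_left hx)))
  · have h := mfderiv_comp x₀ (g := f) (I' := 𝓘(ℝ, E4)) (I'' := 𝓘(ℝ, ℝ))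
      ((hf.contDiffAt (hΩ.mem_nhds hx₀)).differentiableAt (by simp)).mdifferentiableAt
      (mdifferentiableAt_extChartAt (I := 𝓡 4) (x := x₀) (mem_chart_source E4 x₀))
    rw [mfderiv_eq_fderiv] at h
    have hev' : (fun x => χ x * f (φ x)) =ᶠ[nhds x₀] f ∘ φ := hev
    rw [differential, hev'.mfderiv_eq]
    exact congrArg (fun L => L v) h

theorem exists_contMDiff_differential_eq (x₀ : M)
    (ξ : Module.Dual ℝ (TangentSpace (𝓡 4) x₀)) :
    ∃ F : M → ℝ, ContMDiff (𝓡 4) 𝓘(ℝ, ℝ) ∞ F ∧ differential F x₀ = ξ := by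
  obtain ⟨ℓ, hℓ⟩ := exists_linear_of_covector x₀ ξ
  obtain ⟨F, hF, -, hd⟩ := exists_contMDiff_extension x₀ isOpen_univ (Set.mem_univ _)
    ℓ.contDiff.contDiffOn
  refine ⟨F, hF, LinearMap.ext fun v => ?_⟩
  rw [hd, ContinuousLinearMap.fderiv, hℓ]

variable {g : LorentzMetric M}

/-- A covector annihilating the four-velocity at `γ(τ₀)` is the differential there of a smooth
function that vanishes along the worldline at proper times close to `τ₀`. In a chart, with `c` the coordinate expression of the worldline, `α` an index
with `c^α` of nonzero derivative and `h` the local inverse of `c^α`, the function is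
`ℓ(q) - ℓ(c(h(q^α)))`. -/
theorem Worldline.exists_contMDiff_vanishing (γ : Worldline g) {τ₀ : ℝ} (hτ₀ : τ₀ ∈ γ.dom)
    (ξ : Module.Dual ℝ (TangentSpace (𝓡 4) (γ.pos τ₀))) (hξ : ξ (γ.velocity τ₀) = 0) :
    ∃ F : M → ℝ, ContMDiff (𝓡 4) 𝓘(ℝ, ℝ) ∞ F ∧ differential F (γ.pos τ₀) = ξ ∧
      ∀ᶠ τ in nhds τ₀, F (γ.pos τ) = 0 := by
  have : IsManifold (𝓡 4) 1 M := IsManifold.of_le (n := ∞) (by simp)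
  obtain ⟨ℓ, hℓ⟩ := exists_linear_of_covector _ ξ
  set x₀ := γ.pos τ₀ with hx₀
  set φ := extChartAt (𝓡 4) x₀ with hφ
  set J : Set ℝ := γ.dom ∩ γ.pos ⁻¹' φ.source
  have hJ : IsOpen J :=
    γ.smooth.continuousOn.isOpen_inter_preimage γ.dom_open (isOpen_extChartAt_source x₀)
  have hτJ : τ₀ ∈ J := ⟨hτ₀, mem_extChartAt_source x₀⟩
  let c : ℝ → E4 := fun τ => φ (γ.pos τ)
  have hc : ContDiffOn ℝ ∞ c J := by
    rw [← contMDiffOn_iff_contDiffOn]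
    have h1 : ContMDiffOn (𝓡 4) 𝓘(ℝ, E4) ∞ φ φ.source := by
      rw [hφ, extChartAt_source]; exact contMDiffOn_extChartAt
    exact h1.comp (γ.smooth.mono Set.inter_subset_left) Set.inter_subset_right
  have hcd : HasFDerivAt c (fderiv ℝ c τ₀) τ₀ :=
    ((hc.contDiffAt (hJ.mem_nhds hτJ)).differentiableAt (by simp)).hasFDerivAt
  have hc' : fderiv ℝ c τ₀ 1 = mfderiv (𝓡 4) (𝓡 4) φ x₀ (γ.velocity τ₀) := by
    have h := mfderiv_comp τ₀ (g := φ) (f := γ.pos) (I := 𝓘(ℝ, ℝ)) (I' := 𝓡 4) (I'' := 𝓘(ℝ, E4))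
      (mdifferentiableAt_extChartAt (I := 𝓡 4) (x := x₀) (mem_chart_source E4 x₀))
      ((γ.smooth.contMDiffAt (γ.dom_open.mem_nhds hτ₀)).mdifferentiableAt (by simp))
    rw [← mfderiv_eq_fderiv]
    exact congrArg (fun L => L (1 : ℝ)) h
  have hc0 : fderiv ℝ c τ₀ 1 ≠ 0 := by
    rw [hc']
    obtain ⟨E, hE⟩ := isInvertible_mfderiv_extChartAt (I := 𝓡 4) (mem_extChartAt_source x₀)
    rw [← hE]
    intro h
    exact γ.velocity_ne_zero hτ₀ (E.injective (h.trans (E.map_zero).symm))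
  obtain ⟨α, hα⟩ : ∃ α, fderiv ℝ c τ₀ 1 α ≠ 0 := by
    by_contra! h
    exact hc0 (by ext i; exact h i)
  let p : E4 →L[ℝ] ℝ := EuclideanSpace.proj α
  have hcomp (L : E4 →L[ℝ] ℝ) : HasDerivAt (fun τ => L (c τ)) (L (fderiv ℝ c τ₀ 1)) τ₀ :=
    (L.hasFDerivAt.comp τ₀ hcd).hasDerivAt
  obtain ⟨k, V, hV, hmem, hk, hk', hev⟩ := exists_factor_of_deriv_ne_zero hJ
    (p.contDiff.comp_contDiffOn hc) (ℓ.contDiff.comp_contDiffOn hc) hτJ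
    (by rw [show (p ∘ c) = fun τ => p (c τ) from rfl, (hcomp p).deriv]; exact hα)
    (by rw [show (ℓ ∘ c) = fun τ => ℓ (c τ) from rfl, (hcomp ℓ).deriv, hc', hℓ, hξ])
  have hf : ContDiffOn ℝ ∞ (fun q => ℓ q - k (p q)) (p ⁻¹' V) :=
    ℓ.contDiff.contDiffOn.sub (hk.comp p.contDiff.contDiffOn fun _ h => h)
  obtain ⟨F, hF, hFev, hd⟩ := exists_contMDiff_extension x₀ (hV.preimage p.continuous) hmem hf
  refine ⟨F, hF, LinearMap.ext fun v => ?_, ?_⟩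
  · have hfd : HasFDerivAt (fun q => ℓ q - k (p q)) ℓ (φ x₀) := by
      have h := ℓ.hasFDerivAt.sub (hk'.comp_hasFDerivAt (φ x₀) p.hasFDerivAt)
      rwa [zero_smul, sub_zero] at h
    rw [hd, hfd.fderiv, hℓ]
  · have hcont : ContinuousAt γ.pos τ₀ :=
      γ.smooth.continuousOn.continuousAt (γ.dom_open.mem_nhds hτ₀)
    filter_upwards [hcont.eventually hFev, hev] with τ h1 h2
    rw [h1]
    exact sub_eq_zero.2 h2.symm

end Construction

/-! ### Vanishing of the multipoles -/

section Vanishing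

/-- A nonnegative continuous function of compact support in an open set, with integral zero, is zero
there. -/
theorem eqOn_zero_of_setIntegral_eq_zero {J C : Set ℝ} (hJ : IsOpen J) (hC : IsCompact C)
    (hCJ : C ⊆ J) {f : ℝ → ℝ} (hf : ContinuousOn f J) (hsupp : ∀ τ ∈ J, τ ∉ C → f τ = 0)
    (hnonneg : ∀ τ ∈ J, 0 ≤ f τ) (hint : ∫ τ in J, f τ = 0) : ∀ τ ∈ J, f τ = 0 := by
  -- Integrability is needed since the integral of a non-integrable function is zero by convention.
  have hi : MeasureTheory.IntegrableOn f J :=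
    ((hf.mono hCJ).integrableOn_compact hC).of_forall_sdiff_eq_zero hJ.measurableSet
      fun τ hτ => hsupp τ hτ.1 hτ.2
  have h0 := (MeasureTheory.setIntegral_eq_zero_iff_of_nonneg_ae
    (MeasureTheory.ae_restrict_of_forall_mem hJ.measurableSet hnonneg) hi).1 hint
  exact MeasureTheory.Measure.eqOn_open_of_ae_eq h0 hJ hf continuousOn_const

variable {M : Type*} [TopologicalSpace M] [ChartedSpace E4 M] {g : LorentzMetric M}

theorem contract_zero_left {r : ℕ} {x : M} (Z : CovTensor r x) :
    contract (0 : ContraTensor r x) Z = 0 := by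
  simp [contract]

theorem contract_zero_right {r : ℕ} {x : M} (Y : ContraTensor r x) :
    contract Y (0 : CovTensor r x) = 0 := by
  simp [contract]

theorem multipoleDistribution_eq_zero (γ : Worldline g) {m k : ℕ} (Y : TensorAlong γ (m + k))
    {Z : ∀ x : M, CovTensor m x}
    (h : ∀ τ ∈ γ.dom, Y τ = 0 ∨ covDerivIter g Z k (γ.pos τ) = 0) :
    multipoleDistribution γ m k Y Z = 0 := by
  rw [multipoleDistribution, MeasureTheory.setIntegral_congr_fun (g := fun _ => (0 : ℝ))
    γ.dom_open.measurableSet, MeasureTheory.integral_zero, mul_zero]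
  intro τ hτ
  rcases h τ hτ with h0 | h0
  · simp only [h0, contract_zero_left]
  · simp only [h0, contract_zero_right]

theorem sum_multipolarExpansion_apply {p m n : ℕ} (γ : Fin p → Worldline g)
    (Y : ∀ (i : Fin p) (k : Fin (n + 1)), TensorAlong (γ i) (m + k))
    (Z : ∀ x : M, CovTensor m x) :
    (∑ i, multipolarExpansion (γ i) m n (Y i)) Z
      = ∑ i, ∑ k : Fin (n + 1), multipoleDistribution (γ i) m k (Y i k) Z := by
  simp only [multipolarExpansion, Finset.sum_apply]

variable [T2Space M] [IsManifold (𝓡 4) ∞ M]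

/-- If the sum of the expansions is zero and the multipoles of order greater than `N` along the
`i`-th worldline vanish, then so does the one of order `N`, at points off the other worldlines. -/
theorem multipole_eq_zero_of_higher {p m n : ℕ} {γ : Fin p → Worldline g}
    {Y : ∀ (i : Fin p) (k : Fin (n + 1)), TensorAlong (γ i) (m + k)}
    (hzero : IsZeroDistribution (∑ i : Fin p, multipolarExpansion (γ i) m n (Y i)))
    {i : Fin p} {N : Fin (n + 1)} (hcont : ContinuousAlong (γ i) (Y i N))
    (hsymm : SymmetricInK (γ i) (Y i N)) (horth : OrthogonalInK (γ i) (Y i N))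
    (hhigh : ∀ k, N < k → ∀ τ ∈ (γ i).dom, Y i k τ = 0)
    {τ₀ : ℝ} (hτ₀ : τ₀ ∈ (γ i).dom) (hoff : ∀ j, j ≠ i → (γ i).pos τ₀ ∉ (γ j).image) :
    Y i N τ₀ = 0 := by
  by_contra hY
  obtain ⟨η, ξ, hξ, hηξ⟩ := exists_ne_zero_diagonal (Y i N τ₀) (hsymm τ₀ hτ₀)
    (w := g.val ((γ i).pos τ₀) ((γ i).velocity τ₀)) (horth τ₀ hτ₀)
    (Module.Dual.eval ℝ _ ((γ i).velocity τ₀))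
    (by
      have h := (γ i).unit_timelike τ₀ hτ₀
      change g.val _ ((γ i).velocity τ₀) ((γ i).velocity τ₀) ≠ 0
      change g.val _ ((γ i).velocity τ₀) ((γ i).velocity τ₀) = -1 at h
      rw [h]; norm_num) hY
  obtain ⟨F, hF, hdF, hF0⟩ := (γ i).exists_contMDiff_vanishing hτ₀ ξ hξ
  choose H hH hdH using fun j => exists_contMDiff_differential_eq ((γ i).pos τ₀) (η j)
  let D : Fin (m + N) → M → ℝ := Fin.append H (fun _ => F)
  have hD (l : Fin (m + N)) : ContMDiff (𝓡 4) 𝓘(ℝ, ℝ) ∞ (D l) := by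
    refine Fin.addCases (fun j => ?_) (fun j => ?_) l
    · simpa only [D, Fin.append_left] using hH j
    · simpa only [D, Fin.append_right] using hF
  let Ψ : ℝ → ℝ := fun τ => Y i N τ (fun l => differential (D l) ((γ i).pos τ))
  have hΨ₀ : Ψ τ₀ ≠ 0 := by
    have hD₀ : (fun l => differential (D l) ((γ i).pos τ₀)) = Fin.append η (fun _ => ξ) := by
      funext l
      refine Fin.addCases (fun j => ?_) (fun j => ?_) l
      · simp only [D, Fin.append_left, hdH]
      · simp only [D, Fin.append_right, hdF]
    simpa only [Ψ, hD₀] using hηξ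
  have hΨ {τ : ℝ} (hτ : τ ∈ (γ i).dom) : ContinuousAt Ψ τ := hcont.continuousAt_differential hD hτ
  -- On `S` the function `F` vanishes along the worldline and `Ψ` does not change sign.
  have hev : ∀ᶠ τ in nhds τ₀, F ((γ i).pos τ) = 0 ∧ 0 < Ψ τ * Ψ τ₀ :=
    hF0.and (((hΨ hτ₀).mul continuousAt_const).eventually
      (lt_mem_nhds (mul_self_pos.2 hΨ₀)))
  obtain ⟨S, hS, hSo, hτS⟩ := mem_nhds_iff.1 hev
  obtain ⟨U, hU, hUS⟩ := (γ i).exists_nhds_preimage_subset (x₀ := (γ i).pos τ₀) hSo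
    fun τ hτ h => by rwa [(γ i).injective hτ hτ₀ h]
  have hU' : U ∩ ⋂ j ∈ (Finset.univ.erase i : Finset (Fin p)), (γ j).imageᶜ
      ∈ nhds ((γ i).pos τ₀) := by
    refine Filter.inter_mem hU ((Filter.biInter_finset_mem _).2 fun j hj => ?_)
    exact (γ j).isClosed_image.isOpen_compl.mem_nhds (hoff j (Finset.ne_of_mem_erase hj))
  obtain ⟨χ, hχ, hχc, hχU, hχ1, hχ0⟩ := exists_contMDiff_bump hU'
  set Z : ∀ x : M, CovTensor m x := productTensor (fun y => χ y * F y ^ (N : ℕ)) H with hZdef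
  have hZtest : IsTestField Z :=
    isTestField_productTensor (hχ.mul (hF.pow _)) hH hχc.mul_right
  have hZoff {x : M} (hx : x ∉ tsupport χ) (k : ℕ) : covDerivIter g Z k x = 0 := by
    refine covDerivIter_eq_zero_of_eventuallyEq g ?_ k
    filter_upwards [notMem_tsupport_iff_eventuallyEq.1 hx] with y hy
    ext v
    rw [productTensor_apply, hy, Pi.zero_apply, zero_mul, zero_mul, zero_apply]
  have hcase (τ : ℝ) (hτ : τ ∈ (γ i).dom) : τ ∈ S ∨ (γ i).pos τ ∉ tsupport χ := by
    by_cases h : (γ i).pos τ ∈ tsupport χ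
    · exact Or.inl (hUS τ hτ (hχU h).1)
    · exact Or.inr h
  have hother (j : Fin p) (hj : j ≠ i) (k : Fin (n + 1)) :
      multipoleDistribution (γ j) m k (Y j k) Z = 0 := by
    refine multipoleDistribution_eq_zero _ _ fun τ hτ => Or.inr (hZoff (fun hx => ?_) k)
    have h := (hχU hx).2
    simp only [Finset.mem_erase, Finset.mem_univ, and_true, Set.mem_iInter] at h
    exact h j hj ⟨τ, hτ, rfl⟩
  have horder (k : Fin (n + 1)) (hk : k ≠ N) :
      multipoleDistribution (γ i) m k (Y i k) Z = 0 := by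
    refine multipoleDistribution_eq_zero _ _ fun τ hτ => ?_
    rcases lt_or_gt_of_ne hk with hlt | hgt
    · right
      rcases hcase τ hτ with hτS | hx
      · exact covDerivIter_productTensor_eq_zero g hχ hF hH hlt (hS hτS).1
      · exact hZoff hx k
    · exact Or.inl (hhigh k hgt τ hτ)
  have hleading : multipoleDistribution (γ i) m N (Y i N) Z
      = (-1) ^ (N : ℕ) * ((N : ℕ).factorial * ∫ τ in (γ i).dom, χ ((γ i).pos τ) * Ψ τ) := by
    rw [multipoleDistribution, ← MeasureTheory.integral_const_mul ((N : ℕ).factorial : ℝ)]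
    congr 1
    refine MeasureTheory.setIntegral_congr_fun (γ i).dom_open.measurableSet fun τ hτ => ?_
    rcases hcase τ hτ with hτS | hx
    · exact contract_covDerivIter_productTensor g hχ hF hH (hS hτS).1 (Y i N τ)
    · simp only [hZoff hx, contract_zero_right, image_eq_zero_of_notMem_tsupport hx, zero_mul,
        mul_zero]
  have hsum := hzero Z hZtest
  rw [sum_multipolarExpansion_apply, Finset.sum_eq_single i
    (fun j _ hj => Finset.sum_eq_zero fun k _ => hother j hj k) (by simp),
    Finset.sum_eq_single N (fun k _ hk => horder k hk) (by simp), hleading] at hsum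
  have hint : ∫ τ in (γ i).dom, χ ((γ i).pos τ) * Ψ τ = 0 := by
    have hfac : ((N : ℕ).factorial : ℝ) ≠ 0 := by positivity
    simpa [hfac] using hsum
  -- The factor `Ψ τ₀` makes the integrand nonnegative.
  have hzero' := eqOn_zero_of_setIntegral_eq_zero (γ i).dom_open ((γ i).proper _ hχc)
    Set.inter_subset_left (f := fun τ => χ ((γ i).pos τ) * Ψ τ * Ψ τ₀)
    (fun τ hτ => (((hχ.continuous.continuousAt.comp ((γ i).continuousAt hτ)).mul
      (hΨ hτ)).mul continuousAt_const).continuousWithinAt)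
    (fun τ hτ hτC => by
      rw [image_eq_zero_of_notMem_tsupport fun h => hτC ⟨hτ, h⟩, zero_mul, zero_mul])
    (fun τ hτ => by
      rcases hcase τ hτ with hτS | hx
      · rw [mul_assoc]
        exact mul_nonneg (hχ0 _) (hS hτS).2.le
      · rw [image_eq_zero_of_notMem_tsupport hx, zero_mul, zero_mul])
    (by rw [MeasureTheory.integral_mul_const, hint, zero_mul]) τ₀ hτ₀
  simp only [hχ1.self_of_nhds, one_mul] at hzero'
  exact hΨ₀ (mul_self_eq_zero.1 hzero')

end Vanishing

end Spacetime

end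

theorem theorem2 {M : Type*} [TopologicalSpace M] [T2Space M]
    [ChartedSpace (EuclideanSpace ℝ (Fin 4)) M] [IsManifold (𝓡 4) ∞ M]
    (g : Spacetime.LorentzMetric M) (m n p : ℕ)
    (γ : Fin p → Spacetime.Worldline g)
    (hγ : ∀ i j : Fin p, i ≠ j →
      interior {τ : ℝ | τ ∈ (γ i).dom ∧ (γ i).pos τ ∈ (γ j).image} = ∅)
    (Y : ∀ (i : Fin p) (k : Fin (n + 1)), Spacetime.TensorAlong (γ i) (m + k))
    (hcont : ∀ (i : Fin p) (k : Fin (n + 1)), Spacetime.ContinuousAlong (γ i) (Y i k))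
    (hsymm : ∀ (i : Fin p) (k : Fin (n + 1)), Spacetime.SymmetricInK (γ i) (Y i k))
    (horth : ∀ (i : Fin p) (k : Fin (n + 1)), Spacetime.OrthogonalInK (γ i) (Y i k)) :
    Spacetime.IsZeroDistribution
        (∑ i : Fin p, Spacetime.multipolarExpansion (γ i) m n (Y i)) ↔
      ∀ (i : Fin p) (k : Fin (n + 1)), ∀ τ ∈ (γ i).dom, Y i k τ = 0 := by
  constructor
  · intro hzero i k
    -- Induction on the order, starting from the highest one.
    induction k using WellFoundedGT.induction with
    | ind k ih =>
      intro τ hτ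
      exact (hcont i k).eq_zero_of_dense
        (P := fun σ => ∀ j, j ≠ i → (γ i).pos σ ∉ (γ j).image)
        (fun V hV hVdom hne =>
          Spacetime.exists_mem_forall_notMem_image γ hγ i hV hVdom hne)
        (fun σ hσ hoff => Spacetime.multipole_eq_zero_of_higher hzero (hcont i k) (hsymm i k)
          (horth i k) ih hσ hoff) hτ
  · intro h Z _
    rw [Spacetime.sum_multipolarExpansion_apply]
    exact Finset.sum_eq_zero fun i _ => Finset.sum_eq_zero fun k _ =>
      Spacetime.multipoleDistribution_eq_zero _ _ fun τ hτ => Or.inl (h i k τ hτ)
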